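/- Let $(\Omega,\mathscr F,\mathbb P)$ be an atomless probability space, let $p\in[1,\infty)$ and let $q\in(1,\infty]$ be given by $1/p+1/q=1$. For a probability measure $\mathbb Q\ll\mathbb P$ put $H_q\left(\frac{d\mathbb Q}{d\mathbb P}\right)=\frac1{q-1}\log\mathbb E\left[\left(\frac{d\mathbb Q}{d\mathbb P}\right)^q\right]$ if $q<\infty$ and $H_\infty\left(\frac{d\mathbb Q}{d\mathbb P}\right)=\log\left\|\frac{d\mathbb Q}{d\mathbb P}\right\|_\infty$ (possibly $\infty$); put $H_q=\infty$ if $\mathbb Q\not\ll\mathbb P$. For $X\in L^p(\mathbb P)$ and $\alpha\in[0,1)$ define the Rényi entropic value-at-risk $$\mathrm{EVaR}^p_\alpha(X)=\sup\left\{\mathbb E_{\mathbb Q}[X]:\ \mathbb Q\text{ a probability measure with } H_q\left(\tfrac{d\mathbb Q}{d\mathbb P}\right)\le\log\tfrac1{1-\alpha}\right\}.$$ For a decreasing (in the weak sense) function $\Lambda:\mathbb R\to[0,1)$ define $$\mathrm{EVaR}^p_\Lambda(X)=\sup_{x\in\mathbb R}\left\{\mathrm{EVaR}^p_{\Lambda(x)}(X)\wedge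 x\right\},$$ where $a\wedge b=\min\{a,b\}$. For $X,Y\in L^p(\mathbb P)$ let $W_p(X,Y)=\inf\|X'-Y'\|_p$ be the Wasserstein distance of order $p$, the infimum being over all random variables $X',Y'$ on $(\Omega,\mathscr F,\mathbb P)$ such that $X'$ has the law of $X$ and $Y'$ has the law of $Y$. **Proposition.** Let $p\in[1,\infty)$, $\delta\ge0$, and let $\Lambda:\mathbb R\to[0,1)$ be a decreasing function. For every $X\in L^p(\mathbb P)$, $$\sup\left\{\mathrm{EVaR}^p_\Lambda(Y):\ Y\in L^p(\mathbb P),\ W_p(X,Y)\le\delta\right\}=\sup_{x\in\mathbb R}\left\{\left(\mathrm{EVaR}^p_{\Lambda(x)}(X)+\delta\,(1-\Lambda(x))^{-1/p}\right)\wedge x\right\}.$$ -/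

import Mathlib

open MeasureTheory ProbabilityTheory
open scoped ENNReal

noncomputable section

namespace LambdaEVaR

variable {Ω : Type*} [MeasurableSpace Ω]

/-- The measure space is atomless: every measurable set of positive measure has a measurable subset
of strictly smaller positive measure. (Mathlib's `NoAtoms` only says that singletons are null.) -/
def Atomless (P : Measure Ω) : Prop :=
  ∀ A : Set Ω, MeasurableSet A → 0 < P A → ∃ B ⊆ A, MeasurableSet B ∧ 0 < P B ∧ P B < P A

open Classical in
/-- The Rényi entropy `H_q(dQ/dP)` of order `q ∈ [1, ∞]` of a probability measure `Q` with respect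
to a probability measure `P`. It is `∞` when `Q` is not absolutely continuous with respect to `P`
or when the expectation involved is infinite. For `q = 1` it is the relative entropy
`E_P[(dQ/dP) log (dQ/dP)]`, that is, the Kullback-Leibler divergence. -/
def renyiEntropy (q : ℝ≥0∞) (Q P : Measure Ω) : EReal :=
  if Q ≪ P then
    if q = 1 then (InformationTheory.klDiv Q P : EReal)
    else if q = ∞ then ENNReal.log (essSup (Q.rnDeriv P) P)
    else ((1 / (q.toReal - 1) : ℝ) : EReal) *
      ENNReal.log (∫⁻ ω, (Q.rnDeriv P ω) ^ q.toReal ∂P)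
  else ⊤

open Classical in
/-- The Rényi entropic value-at-risk of order `p ∈ [1, ∞)` at level `α ∈ [0, 1]` of `X ∈ L^p(P)`:
for `α < 1` the supremum of `E_Q[X]` over the probability measures `Q` with
`H_q(dQ/dP) ≤ log (1 / (1 - α))`, where `1/p + 1/q = 1`, and the essential supremum for `α = 1`. -/
def EVaR (P : Measure Ω) (p α : ℝ) (X : Ω → ℝ) : EReal :=
  if α = 1 then essSup (fun ω => (X ω : EReal)) P
  else ⨆ (Q : Measure Ω) (_ : IsProbabilityMeasure Q)
    (_ : renyiEntropy (ENNReal.conjExponent (ENNReal.ofReal p)) Q P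
      ≤ ((Real.log (1 / (1 - α)) : ℝ) : EReal)),
    ((∫ ω, X ω ∂Q : ℝ) : EReal)

/-- The Lambda extension of the Rényi entropic value-at-risk,
`sup_{x ∈ ℝ} min (EVaR^p_{Λ(x)}(X), x)`. -/
def lambdaEVaR (P : Measure Ω) (p : ℝ) (Λ : ℝ → ℝ) (X : Ω → ℝ) : EReal :=
  ⨆ x : ℝ, EVaR P p (Λ x) X ⊓ (x : EReal)

/-- The Wasserstein distance of order `p ∈ [1, ∞)` between (the laws of) `X` and `Y`: the infimum of
`‖X' - Y'‖_p` over all random variables `X'`, `Y'` on `(Ω, P)` with the same laws as `X`, `Y`. -/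
def wasserstein (P : Measure Ω) (p : ℝ) (X Y : Ω → ℝ) : ℝ≥0∞ :=
  ⨅ (X' : Ω → ℝ) (Y' : Ω → ℝ) (_ : IdentDistrib X' X P P) (_ : IdentDistrib Y' Y P P),
    eLpNorm (X' - Y') (ENNReal.ofReal p) P

end LambdaEVaR

end

/-!
Write `c = (1 - α) ^ (-1/p)`. For conjugate exponents the constraint `H_q(dQ/dP) ≤ log (1/(1 - α))`
says exactly `‖dQ/dP‖_q ≤ c`, so `EVaR` of level `α` at `X` is the supremum of `E[D X]` over the
probability densities `D` with `‖D‖_q ≤ c` (`EVaR_eq_iSup_isDensity`). The theorem follows from the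
identity `sup {EVaR(Y) : W_p(X, Y) ≤ δ} = EVaR(X) + δ c` at each fixed level: both sides of the
theorem are suprema over `x`, suprema commute, and taking the minimum with `x` is monotone and
commutes with the supremum over `Y`.

For the inequality `≤` (`EVaR_le_add_of_wasserstein_le`), Hölder's inequality gives
`E[D Y'] ≤ E[D X'] + c ‖X' - Y'‖_p` for any copies `X'`, `Y'` of `X`, `Y`, and `EVaR` depends only on
the law of its argument: replacing `D` by its conditional expectation given `X'` does not increase
its norm (`IsDensity.exists_of_identDistrib`).

For `≥` (`exists_wasserstein_le_lt_EVaR`), a density `D` nearly optimal for `X` is first modified so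
that `‖D‖_q = c`, by mixing in a little of the uniform law on a very small event; this is where
atomlessness is used (`IsDensity.exists_lpNorm_eq`). A function `Z` with `‖Z‖_p ≤ 1` and `E[D Z]`
close to `c` (`IsDensity.exists_lpNorm_le_one`) then gives `Y = X + δ Z`, for which `E[D Y]` is close
to `EVaR(X) + δ c`.
-/

namespace LambdaEVaR

variable {Ω : Type*} [MeasurableSpace Ω] {P : Measure Ω} {p q : ℝ≥0∞} {c : ℝ}

/-! ### Densities of bounded `L^q` norm -/

/-- `D` is the density, with respect to `P`, of a probability measure, and `‖D‖_q ≤ c`. For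
`c = (1 - α) ^ (-1/p)` these are the densities over which `EVaR` of level `α` is a supremum.
The function `D` is only required to be nonnegative almost everywhere. -/
structure IsDensity (P : Measure Ω) (q : ℝ≥0∞) (c : ℝ) (D : Ω → ℝ) : Prop where
  memLp : MemLp D q P
  nonneg : 0 ≤ᵐ[P] D
  integral_eq_one : ∫ ω, D ω ∂P = 1
  lpNorm_le : lpNorm D q P ≤ c

theorem abs_integral_mul_le_lpNorm [q.HolderConjugate p] {f g : Ω → ℝ}
    (hf : MemLp f q P) (hg : MemLp g p P) :
    |∫ ω, f ω * g ω ∂P| ≤ lpNorm f q P * lpNorm g p P := by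
  have hi : Integrable (f * g) P := hf.integrable_mul hg
  calc |∫ ω, f ω * g ω ∂P| ≤ ∫ ω, ‖(f * g) ω‖ ∂P :=
        norm_integral_le_integral_norm (f * g)
    _ = lpNorm (f * g) 1 P := (lpNorm_one_eq_integral_norm hi.aestronglyMeasurable).symm
    _ ≤ _ := by
      rw [← toReal_eLpNorm hi.aestronglyMeasurable, ← toReal_eLpNorm hf.1, ← toReal_eLpNorm hg.1,
        ← ENNReal.toReal_mul]
      have hle : eLpNorm (f * g) 1 P ≤ eLpNorm f q P * eLpNorm g p P :=
        eLpNorm_smul_le_mul_eLpNorm (φ := f) (f := g) (p := q) (q := p) (r := 1) hg.1 hf.1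
      exact ENNReal.toReal_mono (ENNReal.mul_ne_top hf.2.ne hg.2.ne) hle

/-- Splitting a set into two parts of positive measure and keeping the smaller one at least halves
the measure; iterating gives sets of arbitrarily small positive measure. -/
theorem Atomless.exists_measure_le [IsFiniteMeasure P] [NeZero P] (hP : Atomless P) {ε : ℝ≥0∞}
    (hε : 0 < ε) : ∃ A, MeasurableSet A ∧ 0 < P A ∧ P A ≤ ε := by
  have halve : ∀ A, MeasurableSet A → 0 < P A →
      ∃ B, MeasurableSet B ∧ 0 < P B ∧ P B ≤ P A / 2 := by
    intro A hA hA0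
    obtain ⟨B, hBA, hB, hB0, hlt⟩ := hP A hA hA0
    have hadd : P B + P (A \ B) = P A := by
      rw [← measure_inter_add_sdiff A hB, Set.inter_eq_self_of_subset_right hBA]
    rcases le_total (P B) (P (A \ B)) with h | h
    · refine ⟨B, hB, hB0, ?_⟩
      rw [ENNReal.le_div_iff_mul_le (by simp) (by simp), mul_two, ← hadd]
      gcongr
    · refine ⟨A \ B, hA.diff hB, ?_, ?_⟩
      · rw [measure_sdiff hBA hB.nullMeasurableSet (measure_ne_top _ _)]
        exact tsub_pos_of_lt hlt
      · rw [ENNReal.le_div_iff_mul_le (by simp) (by simp), mul_two, ← hadd]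
        gcongr
  have hpow : ∀ n : ℕ, ∃ A, MeasurableSet A ∧ 0 < P A ∧ P A ≤ P Set.univ * 2⁻¹ ^ n := by
    intro n
    induction n with
    | zero => exact ⟨Set.univ, .univ, by simpa using NeZero.ne P, by simp⟩
    | succ n ih =>
      obtain ⟨A, hA, hA0, hle⟩ := ih
      obtain ⟨B, hB, hB0, hBle⟩ := halve A hA hA0
      refine ⟨B, hB, hB0, hBle.trans ?_⟩
      rw [pow_succ, ← mul_assoc, ENNReal.div_eq_inv_mul, mul_comm]
      gcongr
  have ht : Filter.Tendsto (fun n : ℕ => P Set.univ * (2⁻¹ : ℝ≥0∞) ^ n) .atTop (nhds 0) := by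
    simpa using ENNReal.Tendsto.const_mul
      (ENNReal.tendsto_pow_atTop_nhds_zero_of_lt_one (r := 2⁻¹) (by simp))
      (Or.inr (measure_ne_top P Set.univ))
  obtain ⟨n, hn⟩ := ((ENNReal.tendsto_nhds_zero.1 ht) ε hε).exists
  obtain ⟨A, hA, hA0, hle⟩ := hpow n
  exact ⟨A, hA, hA0, hle.trans hn⟩

/-- Law invariance: densities can be transported between identically distributed variables. The
conditional expectation of `D` given `X'` is of the form `g(X')`, has the same pairing with `X'`, and
has no larger `L^q` norm; `g(X)` is then the density sought. -/
theorem IsDensity.exists_of_identDistrib [IsProbabilityMeasure P] [q.HolderConjugate p]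
    {D X X' : Ω → ℝ} (hD : IsDensity P q c D) (hX : MemLp X' p P) (h : IdentDistrib X' X P P) :
    ∃ D', IsDensity P q c D' ∧ ∫ ω, D' ω * X ω ∂P = ∫ ω, D ω * X' ω ∂P := by
  have hq1 : 1 ≤ q := ENNReal.HolderConjugate.one_le q p
  set X₀ := h.aemeasurable_fst.mk X'
  -- A measurable version is needed for the σ-algebra generated by `X'` to be a sub-σ-algebra.
  have hX₀m : Measurable X₀ := h.aemeasurable_fst.measurable_mk
  have hae : X' =ᵐ[P] X₀ := h.aemeasurable_fst.ae_eq_mk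
  have h₀ : IdentDistrib X₀ X P P := (IdentDistrib.of_ae_eq h.aemeasurable_fst hae).symm.trans h
  have hX₀p : MemLp X₀ p P := hX.ae_eq hae
  obtain ⟨g, hg, hgeq⟩ := (stronglyMeasurable_condExp
    (m := MeasurableSpace.comap X₀ inferInstance) (μ := P) (f := D)).exists_eq_measurable_comp
  have hid : IdentDistrib (P[D | MeasurableSpace.comap X₀ inferInstance]) (g ∘ X) P P := by
    rw [hgeq]; exact h₀.comp hg.measurable
  have hmem : MemLp (P[D | MeasurableSpace.comap X₀ inferInstance]) q P := hD.memLp.condExp hq1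
  have hmem' : MemLp (g ∘ X) q P := hid.memLp_snd hmem
  have hDi : Integrable D P := hD.memLp.integrable hq1
  have hDX : Integrable (D * X₀) P := hD.memLp.integrable_mul hX₀p
  refine ⟨g ∘ X, ⟨hmem', ?_, ?_, ?_⟩, ?_⟩
  · exact hid.ae_mem_snd measurableSet_Ici (condExp_nonneg hD.nonneg)
  · rw [← hid.integral_eq, integral_condExp hX₀m.comap_le, hD.integral_eq_one]
  · refine le_trans ?_ hD.lpNorm_le
    rw [← toReal_eLpNorm hmem'.1, ← toReal_eLpNorm hD.memLp.1, ← hid.eLpNorm_eq]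
    exact ENNReal.toReal_mono hD.memLp.2.ne (eLpNorm_condExp_le_eLpNorm D hq1)
  · have hpull : P[D * X₀ | MeasurableSpace.comap X₀ inferInstance] =ᵐ[P]
        P[D | MeasurableSpace.comap X₀ inferInstance] * X₀ :=
      condExp_mul_of_stronglyMeasurable_right
        (comap_measurable X₀).stronglyMeasurable hDX hDi
    calc ∫ ω, (g ∘ X) ω * X ω ∂P = ∫ ω, g (X₀ ω) * X₀ ω ∂P :=
          ((h₀.comp (u := fun x => g x * x) (hg.measurable.mul measurable_id)).integral_eq).symm
      _ = ∫ ω, (P[D * X₀ | MeasurableSpace.comap X₀ inferInstance]) ω ∂P := by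
          refine integral_congr_ae ?_
          filter_upwards [hpull] with ω hω
          rw [hω, hgeq]; rfl
      _ = ∫ ω, D ω * X₀ ω ∂P := integral_condExp hX₀m.comap_le
      _ = _ := by
          refine integral_congr_ae ?_
          filter_upwards [hae] with ω hω
          rw [hω]

/-! ### Optimality in Hölder's inequality -/

theorem lpNorm_norm_rpow {f : Ω → ℝ} (hf : AEStronglyMeasurable f P) {r : ℝ} (hr : 0 < r) :
    lpNorm (fun ω => ‖f ω‖ ^ r) p P = lpNorm f (p * ENNReal.ofReal r) P ^ r := by
  rw [← toReal_eLpNorm hf, ← toReal_eLpNorm (by fun_prop (disch := positivity)),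
    eLpNorm_norm_rpow f hr, ENNReal.toReal_rpow]

/-- Near-equality in Hölder's inequality. For `q < ∞` the normalized function `D ^ (q - 1)` attains
`‖D‖_q`; for `q = ∞` the normalized indicator of `{D ≥ ‖D‖_∞ - η}` attains it up to `η`. -/
theorem IsDensity.exists_lpNorm_le_one [IsProbabilityMeasure P] [q.HolderConjugate p]
    (hpt : p ≠ ∞) {D : Ω → ℝ} (hD : IsDensity P q c D) {η : ℝ} (hη : 0 < η) :
    ∃ Z, MemLp Z p P ∧ lpNorm Z p P ≤ 1 ∧ lpNorm D q P - η ≤ ∫ ω, D ω * Z ω ∂P := by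
  have hq1 : 1 ≤ q := ENNReal.HolderConjugate.one_le q p
  have hDi : Integrable D P := hD.memLp.integrable hq1
  have hpos : 0 < lpNorm D q P := by
    refine lpNorm_nonneg.lt_of_ne' fun h0 => ?_
    rw [lpNorm_eq_zero hD.memLp (zero_lt_one.trans_le hq1).ne'] at h0
    have := hD.integral_eq_one
    rw [integral_congr_ae h0] at this
    simp at this
  rcases eq_or_ne q ∞ with rfl | hqt
  · have hp1 : p = 1 := (ENNReal.HolderConjugate.eq_top_iff_eq_one ∞ p).1 rfl
    subst hp1
    set N := lpNorm D ∞ P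
    -- The positive part keeps the bound on `‖D‖` outside `A` valid when `η > ‖D‖_∞`.
    set A := {ω | max (N - η) 0 ≤ hD.memLp.1.mk D ω} with hA
    have hAm : MeasurableSet A :=
      measurableSet_le measurable_const hD.memLp.1.stronglyMeasurable_mk.measurable
    have hA0 : 0 < P A := by
      by_contra h0
      have h0 : P A = 0 := by simpa using h0
      have hae : ∀ᵐ ω ∂P, ‖D ω‖ ≤ max (N - η) 0 := by
        have : ∀ᵐ ω ∂P, ω ∉ A := measure_eq_zero_iff_ae_notMem.1 h0
        filter_upwards [this, hD.memLp.1.ae_eq_mk, hD.nonneg] with ω h1 h2 h3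
        simp only [hA, Set.mem_ofPred_eq, not_le] at h1
        rw [Real.norm_of_nonneg h3, h2]
        exact h1.le
      have hle : N ≤ max (N - η) 0 := by
        have hN' : N = (eLpNorm D ∞ P).toReal := (toReal_eLpNorm hD.memLp.1).symm
        refine hN'.le.trans <| ENNReal.toReal_le_of_le_ofReal (le_max_right _ _) ?_
        rw [eLpNorm_exponent_top]
        exact eLpNormEssSup_le_of_ae_bound hae
      rcases le_max_iff.1 hle with h | h <;> linarith
    have hAr : 0 < P.real A := ENNReal.toReal_pos hA0.ne' (measure_ne_top _ _)
    have hint : Integrable (A.indicator fun _ => (P.real A)⁻¹) P :=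
      (integrable_const _).indicator hAm
    refine ⟨A.indicator fun _ => (P.real A)⁻¹, memLp_one_iff_integrable.2 hint, ?_, ?_⟩
    · rw [lpNorm_one_eq_integral_norm hint.1]
      have : (fun ω => ‖A.indicator (fun _ => (P.real A)⁻¹) ω‖)
          = A.indicator fun _ => (P.real A)⁻¹ := by
        ext ω
        exact Real.norm_of_nonneg (Set.indicator_nonneg (fun _ _ => by positivity) _)
      rw [this, integral_indicator_const _ hAm]
      simp [hAr.ne']
    · calc N - η = ∫ ω, A.indicator (fun _ => (N - η) * (P.real A)⁻¹) ω ∂P := by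
            rw [integral_indicator_const _ hAm]
            simp only [smul_eq_mul]
            field_simp
        _ ≤ _ := by
          refine integral_mono_ae ((integrable_const _).indicator hAm)
            (hD.memLp.integrable_mul (memLp_one_iff_integrable.2 hint)) ?_
          filter_upwards [hD.memLp.1.ae_eq_mk] with ω h1
          by_cases hω : ω ∈ A
          · have : N - η ≤ D ω := by rw [h1]; exact (le_max_left _ _).trans hω
            simp only [Set.indicator_of_mem hω]
            gcongr
          · simp [Set.indicator_of_notMem hω]
  · have hc : p.toReal.HolderConjugate q.toReal :=
      ENNReal.HolderConjugate.toReal_of_ne_top hpt hqt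
    set r := q.toReal
    have hr1 : 1 < r := hc.symm.lt
    have hr' : 0 < r - 1 := by linarith
    set N := lpNorm D q P with hN
    have hpq : p * ENNReal.ofReal (r - 1) = q := by
      rw [← ENNReal.ofReal_toReal hpt, ← ENNReal.ofReal_mul hc.nonneg, ← ENNReal.ofReal_toReal hqt]
      congr 1
      have := hc.mul_eq_add
      linarith
    have hZn : lpNorm (fun ω => ‖D ω‖ ^ (r - 1)) p P = N ^ (r - 1) := by
      rw [lpNorm_norm_rpow hD.memLp.1 hr', hpq]
    have hZm : MemLp (fun ω => ‖D ω‖ ^ (r - 1)) p P := by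
      refine ⟨by have := hD.memLp.1; fun_prop (disch := positivity), ?_⟩
      rw [eLpNorm_norm_rpow D hr', hpq]
      exact ENNReal.rpow_lt_top_of_nonneg hr'.le hD.memLp.2.ne
    refine ⟨(N ^ (r - 1))⁻¹ • fun ω => ‖D ω‖ ^ (r - 1), hZm.const_smul _, ?_, ?_⟩
    · rw [lpNorm_const_smul, hZn, coe_nnnorm, Real.norm_of_nonneg (by positivity),
        inv_mul_cancel₀ (by positivity)]
    · have hNr : N ^ r = ∫ ω, ‖D ω‖ ^ r ∂P := by
        rw [hN, lpNorm_eq_integral_norm_rpow_toReal (by positivity) hqt hD.memLp.1,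
          ← Real.rpow_mul (by positivity), inv_mul_cancel₀ (by positivity), Real.rpow_one]
      have : ∫ ω, D ω * ((N ^ (r - 1))⁻¹ • fun ω => ‖D ω‖ ^ (r - 1)) ω ∂P = N := by
        calc _ = ∫ ω, (N ^ (r - 1))⁻¹ * ‖D ω‖ ^ r ∂P := by
              refine integral_congr_ae ?_
              filter_upwards [hD.nonneg] with ω hω
              have h0 : 0 ≤ D ω := hω
              simp only [Pi.smul_apply, smul_eq_mul, Real.norm_of_nonneg h0]
              have : D ω ^ r = D ω * D ω ^ (r - 1) := by
                conv_rhs => rw [mul_comm, ← Real.rpow_add_one' h0 (by linarith), sub_add_cancel]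
              rw [this]; ring
          _ = _ := by
              rw [integral_const_mul, ← hNr, Real.rpow_sub_one hpos.ne']
              field_simp
      linarith

/-! ### Saturating the norm constraint -/

/-- On an atomless space the constraint `‖D‖_q ≤ c` may be taken to be an equality at the cost of an
arbitrarily small change of `E[D X]`. The new density is `(1 - t) D + t S` with `S = 1_A / P(A)` and
`P(A)` small: `‖S‖_q ≥ c`, so some `t ∈ [0, 1]` makes the norm equal to `c`; for this `t` the
triangle inequality gives `t ‖S‖_q ≤ 2 c`. Hence `t` is small and, by Hölder's inequality,
`|t E[S X]| ≤ 2 c ‖X 1_A‖_p` is small too. -/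
theorem IsDensity.exists_lpNorm_eq [IsProbabilityMeasure P] [q.HolderConjugate p] (hpt : p ≠ ∞)
    (hP : Atomless P) {D X : Ω → ℝ} (hD : IsDensity P q c D) (hX : MemLp X p P) {η : ℝ}
    (hη : 0 < η) :
    ∃ D', IsDensity P q c D' ∧ lpNorm D' q P = c ∧
      ∫ ω, D ω * X ω ∂P - η ≤ ∫ ω, D' ω * X ω ∂P := by
  have hq1 : 1 ≤ q := ENNReal.HolderConjugate.one_le q p
  have hp1 : 1 ≤ p := ENNReal.HolderConjugate.one_le p q
  have hc0 : 0 ≤ c := lpNorm_nonneg.trans hD.lpNorm_le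
  set x := lpNorm X p P
  have hx0 : 0 ≤ x := lpNorm_nonneg
  -- `M` is to be a lower bound for `‖S‖_q`: the second term makes `t c ‖X‖_p ≤ η / 2`, since
  -- `t ≤ 2 c / M`, and the last one keeps `M` positive.
  set M := c + 4 * c ^ 2 * x / η + 1 with hM
  have hM0 : 0 < M := by positivity
  obtain ⟨d₁, hd₁, h₁⟩ := hX.eLpNorm_indicator_le hp1 hpt (ε := η / (4 * (c + 1))) (by positivity)
  obtain ⟨d₂, hd₂, h₂⟩ := (memLp_const (μ := P) (1 : ℝ)).eLpNorm_indicator_le hp1 hpt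
    (ε := M⁻¹) (by positivity)
  obtain ⟨A, hAm, hA0, hA⟩ := hP.exists_measure_le (P := P)
    (ε := min (ENNReal.ofReal d₁) (ENNReal.ofReal d₂)) (by simp [hd₁, hd₂])
  have hAr : 0 < P.real A := ENNReal.toReal_pos hA0.ne' (measure_ne_top _ _)
  have hXA : MemLp (A.indicator X) p P := hX.indicator hAm
  have h1A : MemLp (A.indicator fun _ => (1 : ℝ)) p P := (memLp_const _).indicator hAm
  have hXA' : lpNorm (A.indicator X) p P ≤ η / (4 * (c + 1)) := by
    rw [← toReal_eLpNorm hXA.1]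
    exact ENNReal.toReal_le_of_le_ofReal (by positivity) (h₁ A hAm (hA.trans (min_le_left _ _)))
  have h1A' : lpNorm (A.indicator fun _ => (1 : ℝ)) p P ≤ M⁻¹ := by
    rw [← toReal_eLpNorm h1A.1]
    exact ENNReal.toReal_le_of_le_ofReal (by positivity) (h₂ A hAm (hA.trans (min_le_right _ _)))
  set S : Ω → ℝ := A.indicator fun _ => (P.real A)⁻¹ with hS
  have hSm : MemLp S q P := (memLp_const _).indicator hAm
  have hS1 : ∫ ω, S ω ∂P = 1 := by
    rw [hS, integral_indicator_const _ hAm]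
    simp [hAr.ne']
  have hSn : 0 ≤ S := fun ω => Set.indicator_nonneg (fun _ _ => by positivity) ω
  have hSmul : ∀ f : Ω → ℝ, ∫ ω, S ω * A.indicator f ω ∂P = ∫ ω, S ω * f ω ∂P := by
    intro f
    congr 1 with ω
    by_cases hω : ω ∈ A <;> simp [hS, hω]
  -- `1 = E[S 1_A] ≤ ‖S‖_q ‖1_A‖_p ≤ ‖S‖_q / M`.
  have hSM : M ≤ lpNorm S q P := by
    have h := abs_integral_mul_le_lpNorm hSm h1A
    rw [hSmul] at h
    simp only [mul_one, hS1, abs_one] at h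
    have := h.trans (mul_le_mul_of_nonneg_left h1A' lpNorm_nonneg)
    rwa [← div_eq_mul_inv, one_le_div hM0] at this
  have : Fact (1 ≤ q) := ⟨hq1⟩
  have hmem : ∀ t : ℝ, MemLp ((1 - t) • D + t • S) q P := fun t =>
    (hD.memLp.const_smul _).add (hSm.const_smul _)
  have hcont : Continuous fun t : ℝ => lpNorm ((1 - t) • D + t • S) q P := by
    have : (fun t : ℝ => lpNorm ((1 - t) • D + t • S) q P)
        = fun t : ℝ => ‖(1 - t) • hD.memLp.toLp D + t • hSm.toLp S‖ := by
      ext t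
      rw [← toReal_eLpNorm (hmem t).1, ← Lp.norm_toLp _ (hmem t)]
      rfl
    rw [this]
    fun_prop
  have hMc : c ≤ M := by
    have : 0 ≤ 4 * c ^ 2 * x / η := by positivity
    linarith
  obtain ⟨t, ⟨ht0, ht1⟩, ht⟩ := intermediate_value_Icc (zero_le_one' ℝ) hcont.continuousOn
    (show c ∈ Set.Icc _ _ from ⟨by simpa using hD.lpNorm_le, by simpa using hMc.trans hSM⟩)
  have ht : lpNorm ((1 - t) • D + t • S) q P = c := ht
  have hDi : Integrable D P := hD.memLp.integrable hq1
  have hSi : Integrable S P := hSm.integrable hq1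
  have htS : t * lpNorm S q P ≤ 2 * c := by
    have h := lpNorm_le_add_lpNorm_add (f := t • S) (hD.memLp.const_smul (1 - t)) hq1
    rw [add_comm (t • S), ht, lpNorm_const_smul, lpNorm_const_smul, coe_nnnorm, coe_nnnorm,
      Real.norm_of_nonneg ht0, Real.norm_of_nonneg (sub_nonneg.2 ht1)] at h
    have : (1 - t) * lpNorm D q P ≤ 1 * c := by
      gcongr
      · exact lpNorm_nonneg
      · linarith
      · exact hD.lpNorm_le
    linarith
  have hDX : |∫ ω, D ω * X ω ∂P| ≤ c * x :=
    (abs_integral_mul_le_lpNorm hD.memLp hX).trans (by gcongr; exact hD.lpNorm_le)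
  have hSX : |∫ ω, S ω * X ω ∂P| ≤ lpNorm S q P * (η / (4 * (c + 1))) := by
    rw [← hSmul X]
    exact (abs_integral_mul_le_lpNorm hSm hXA).trans (by gcongr; exact lpNorm_nonneg)
  have hDXi : Integrable (fun ω => D ω * X ω) P := hD.memLp.integrable_mul hX
  have hSXi : Integrable (fun ω => S ω * X ω) P := hSm.integrable_mul hX
  refine ⟨(1 - t) • D + t • S, ⟨hmem t, ?_, ?_, ht.le⟩, ht, ?_⟩
  · filter_upwards [hD.nonneg] with ω hω
    have h0 : 0 ≤ D ω := hω
    have h1 : 0 ≤ S ω := hSn ω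
    have h2 : 0 ≤ 1 - t := by linarith
    simp only [Pi.zero_apply, Pi.add_apply, Pi.smul_apply, smul_eq_mul]
    positivity
  · simp only [Pi.add_apply, Pi.smul_apply, smul_eq_mul]
    rw [integral_add (hDi.const_mul _) (hSi.const_mul _), integral_const_mul, integral_const_mul,
      hS1, hD.integral_eq_one]
    ring
  · have heq : ∫ ω, ((1 - t) • D + t • S) ω * X ω ∂P
        = (1 - t) * ∫ ω, D ω * X ω ∂P + t * ∫ ω, S ω * X ω ∂P := by
      rw [← integral_const_mul, ← integral_const_mul,
        ← integral_add (hDXi.const_mul _) (hSXi.const_mul _)]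
      congr 1 with ω
      simp only [Pi.add_apply, Pi.smul_apply, smul_eq_mul]
      ring
    have e1 : t * ∫ ω, D ω * X ω ∂P ≤ η / 2 := by
      have a1 : t * M ≤ 2 * c := (mul_le_mul_of_nonneg_left hSM ht0).trans htS
      have a2 : t * (4 * c ^ 2 * x / η) ≤ 2 * c :=
        (mul_le_mul_of_nonneg_left (by rw [hM]; linarith) ht0).trans a1
      have a3 : t * ∫ ω, D ω * X ω ∂P ≤ t * (c * x) := by
        gcongr
        exact (le_abs_self _).trans hDX
      rcases hc0.eq_or_lt with hc | hc
      · rw [← hc] at a3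
        linarith
      · refine a3.trans ?_
        have : t * (4 * c ^ 2 * x / η) = (2 * c) * (2 / η * (t * (c * x))) := by ring
        rw [this] at a2
        have a4 : 2 / η * (t * (c * x)) ≤ 1 := le_of_mul_le_mul_left (by linarith) (by linarith :
          0 < 2 * c)
        rw [div_mul_eq_mul_div, div_le_one hη] at a4
        linarith
    have e2 : -(η / 2) ≤ t * ∫ ω, S ω * X ω ∂P := by
      have b1 : |t * ∫ ω, S ω * X ω ∂P| ≤ η / 2 := by
        rw [abs_mul, abs_of_nonneg ht0]
        calc t * |∫ ω, S ω * X ω ∂P| ≤ t * (lpNorm S q P * (η / (4 * (c + 1)))) := by gcongr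
          _ = t * lpNorm S q P * (η / (4 * (c + 1))) := by ring
          _ ≤ (2 * c) * (η / (4 * (c + 1))) := by gcongr
          _ ≤ (2 * (c + 1)) * (η / (4 * (c + 1))) := by gcongr; linarith
          _ = η / 2 := by field_simp; norm_num
      exact neg_le_of_abs_le b1
    rw [heq]
    linarith

/-! ### The entropic value-at-risk as a supremum over densities -/

/-- For conjugate exponents `1/p = (q - 1)/q`, so the entropy constraint is the norm constraint
`‖dQ/dP‖_q ≤ (1 - α) ^ (-1/p)`, for `p = 1`, `q = ∞` as well. -/
theorem renyiEntropy_le_log_iff {p α : ℝ} (hp : 1 ≤ p) (hα : α < 1) {Q : Measure Ω}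
    (hQ : Q ≪ P) :
    renyiEntropy (ENNReal.conjExponent (ENNReal.ofReal p)) Q P
        ≤ ((Real.log (1 / (1 - α)) : ℝ) : EReal) ↔
      eLpNorm (Q.rnDeriv P) (ENNReal.conjExponent (ENNReal.ofReal p)) P
        ≤ ENNReal.ofReal ((1 - α) ^ (-(1 / p))) := by
  have h1 : 0 < 1 - α := by linarith
  have hR : 0 < 1 / (1 - α) := by positivity
  rw [renyiEntropy, if_pos hQ, ← ENNReal.log_ofReal_of_pos hR]
  rcases hp.eq_or_lt with rfl | hp1
  · have : ENNReal.conjExponent (ENNReal.ofReal 1) = ∞ := by simp [ENNReal.conjExponent]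
    rw [this, if_neg (by simp), if_pos rfl, ENNReal.log_le_log_iff, eLpNorm_exponent_top,
      eLpNormEssSup]
    simp [Real.rpow_neg_one]
  · have hp0 : 0 < p := by linarith
    have : (ENNReal.ofReal p).HolderConjugate (ENNReal.conjExponent (ENNReal.ofReal p)) :=
      .conjExponent (by simpa using hp)
    set q := ENNReal.conjExponent (ENNReal.ofReal p)
    have hqt : q ≠ ∞ := by
      rw [ne_eq, ENNReal.HolderConjugate.eq_top_iff_eq_one q (ENNReal.ofReal p)]
      simpa using hp1.ne'
    have hq1 : q ≠ 1 := by
      rw [ne_eq, ← ENNReal.HolderConjugate.eq_top_iff_eq_one (ENNReal.ofReal p) q]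
      simp
    have hc : p.HolderConjugate q.toReal := by
      simpa [hp0.le] using
        ENNReal.HolderConjugate.toReal_of_ne_top (p := ENNReal.ofReal p) ENNReal.ofReal_ne_top hqt
    have hc1 : 0 < q.toReal - 1 := by linarith [hc.symm.lt]
    have hexp : 1 / q.toReal = 1 / (q.toReal - 1) * (1 / p) := by
      have := hc.mul_eq_add
      have := hc.symm.pos
      field_simp
      linarith
    rw [if_neg hq1, if_neg hqt, ← ENNReal.log_rpow, ENNReal.log_le_log_iff,
      eLpNorm_eq_lintegral_rpow_enorm_toReal (ENNReal.HolderConjugate.ne_zero q (ENNReal.ofReal p))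
      hqt, hexp, ENNReal.rpow_mul]
    have : ENNReal.ofReal ((1 - α) ^ (-(1 / p))) = ENNReal.ofReal (1 / (1 - α)) ^ (1 / p) := by
      rw [ENNReal.ofReal_rpow_of_pos hR, one_div (1 - α), Real.inv_rpow h1.le, Real.rpow_neg h1.le]
    rw [this, ENNReal.rpow_le_rpow_iff (by positivity)]
    simp

theorem eLpNorm_toReal_rnDeriv {Q : Measure Ω} [SigmaFinite Q] :
    eLpNorm (fun ω => (Q.rnDeriv P ω).toReal) q P = eLpNorm (Q.rnDeriv P) q P := by
  refine eLpNorm_congr_enorm_ae ?_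
  filter_upwards [Q.rnDeriv_lt_top P] with ω hω
  rw [Real.enorm_of_nonneg ENNReal.toReal_nonneg, ENNReal.ofReal_toReal hω.ne, enorm_eq_self]

theorem EVaR_eq_iSup_isDensity [IsProbabilityMeasure P] {p α : ℝ} (hp : 1 ≤ p) (hα : α < 1)
    (X : Ω → ℝ) :
    EVaR P p α X = ⨆ (D : Ω → ℝ) (_ : IsDensity P (ENNReal.conjExponent (ENNReal.ofReal p))
      ((1 - α) ^ (-(1 / p))) D), ((∫ ω, D ω * X ω ∂P : ℝ) : EReal) := by
  have hc0 : 0 ≤ (1 - α) ^ (-(1 / p)) := Real.rpow_nonneg (by linarith) _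
  have : (ENNReal.ofReal p).HolderConjugate (ENNReal.conjExponent (ENNReal.ofReal p)) :=
      .conjExponent (by simpa using hp)
  have hq1 := ENNReal.HolderConjugate.one_le (ENNReal.conjExponent (ENNReal.ofReal p))
    (ENNReal.ofReal p)
  rw [EVaR, if_neg hα.ne]
  apply le_antisymm
  · refine iSup_le fun Q => iSup_le fun hQ => iSup_le fun hH => ?_
    have hQP : Q ≪ P := by
      by_contra h
      rw [renyiEntropy, if_neg h] at hH
      exact EReal.coe_ne_top _ (top_le_iff.1 hH)
    rw [renyiEntropy_le_log_iff hp hα hQP, ← eLpNorm_toReal_rnDeriv] at hH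
    have hm : MemLp (fun ω => (Q.rnDeriv P ω).toReal)
        (ENNReal.conjExponent (ENNReal.ofReal p)) P :=
      ⟨(Q.measurable_rnDeriv P).ennreal_toReal.aestronglyMeasurable,
        hH.trans_lt ENNReal.ofReal_lt_top⟩
    refine le_iSup₂_of_le (fun ω => (Q.rnDeriv P ω).toReal) ⟨hm, ?_, ?_, ?_⟩ ?_
    · exact .of_forall fun ω => ENNReal.toReal_nonneg
    · simp [Measure.integral_toReal_rnDeriv hQP]
    · rw [← toReal_eLpNorm hm.1]
      exact ENNReal.toReal_le_of_le_ofReal hc0 hH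
    · rw [integral_toReal_rnDeriv_mul hQP]
  · refine iSup₂_le fun D hD => ?_
    have hDm : AEMeasurable (fun ω => ENNReal.ofReal (D ω)) P :=
      hD.memLp.1.aemeasurable.ennreal_ofReal
    have hDi : Integrable D P := hD.memLp.integrable hq1
    set Q := P.withDensity fun ω => ENNReal.ofReal (D ω) with hQ
    have hQP : Q ≪ P := withDensity_absolutelyContinuous _ _
    have hQ1 : IsProbabilityMeasure Q := ⟨by
      rw [hQ, withDensity_apply _ .univ, setLIntegral_univ,
        ← ofReal_integral_eq_lintegral_ofReal hDi hD.nonneg, hD.integral_eq_one, ENNReal.ofReal_one]⟩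
    have hae : (fun ω => (Q.rnDeriv P ω).toReal) =ᵐ[P] D := by
      filter_upwards [Measure.rnDeriv_withDensity₀ P hDm, hD.nonneg] with ω h1 h2
      rw [hQ, h1, ENNReal.toReal_ofReal h2]
    refine le_iSup_of_le Q (le_iSup_of_le hQ1 (le_iSup_of_le ?_ ?_))
    · rw [renyiEntropy_le_log_iff hp hα hQP, ← eLpNorm_toReal_rnDeriv, eLpNorm_congr_ae hae,
        ← ofReal_lpNorm hD.memLp]
      exact ENNReal.ofReal_le_ofReal hD.lpNorm_le
    · rw [← integral_toReal_rnDeriv_mul hQP]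
      refine (congrArg _ (integral_congr_ae ?_)).le
      filter_upwards [hae] with ω hω
      rw [hω]

/-! ### The value-at-risk over a Wasserstein ball -/

/-- Hölder's inequality bounds the change of `E[D ·]` between coupled copies `X'`, `Y'` of `X`, `Y`;
law invariance carries `D` from `Y` to `Y'` and from `X'` to `X`. -/
theorem EVaR_le_add_of_wasserstein_le [IsProbabilityMeasure P] {p α δ : ℝ} (hp : 1 ≤ p)
    (hα : α < 1) (hδ : 0 ≤ δ) {X Y : Ω → ℝ} (hX : MemLp X (ENNReal.ofReal p) P)
    (hY : MemLp Y (ENNReal.ofReal p) P) (h : wasserstein P p X Y ≤ ENNReal.ofReal δ) :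
    EVaR P p α Y ≤ EVaR P p α X + ((δ * (1 - α) ^ (-(1 / p)) : ℝ) : EReal) := by
  have : (ENNReal.ofReal p).HolderConjugate (ENNReal.conjExponent (ENNReal.ofReal p)) :=
      .conjExponent (by simpa using hp)
  set c := (1 - α) ^ (-(1 / p))
  have hc0 : 0 ≤ c := Real.rpow_nonneg (by linarith) _
  rw [EVaR_eq_iSup_isDensity hp hα Y]
  refine iSup₂_le fun D hD => ?_
  have key : ∀ ε > 0, ((∫ ω, D ω * Y ω ∂P - c * (δ + ε) : ℝ) : EReal) ≤ EVaR P p α X := by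
    intro ε hε
    have hlt : wasserstein P p X Y < ENNReal.ofReal (δ + ε) :=
      h.trans_lt ((ENNReal.ofReal_lt_ofReal_iff (by linarith)).2 (by linarith))
    simp only [wasserstein, iInf_lt_iff] at hlt
    obtain ⟨X', Y', hX', hY', hlt⟩ := hlt
    have hX'm := hX'.symm.memLp_snd hX
    have hY'm := hY'.symm.memLp_snd hY
    obtain ⟨D₁, hD₁, hE₁⟩ := hD.exists_of_identDistrib hY hY'.symm
    obtain ⟨D₂, hD₂, hE₂⟩ := hD₁.exists_of_identDistrib hX'm hX'
    have hdiff : lpNorm (X' - Y') (ENNReal.ofReal p) P ≤ δ + ε := by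
      rw [← toReal_eLpNorm (hX'm.sub hY'm).1]
      exact ENNReal.toReal_le_of_le_ofReal (by linarith) hlt.le
    have hH := abs_integral_mul_le_lpNorm hD₁.memLp (hX'm.sub hY'm)
    have hsub : ∫ ω, D₁ ω * (X' - Y') ω ∂P
        = ∫ ω, D₁ ω * X' ω ∂P - ∫ ω, D₁ ω * Y' ω ∂P := by
      have h1 : Integrable (fun ω => D₁ ω * X' ω) P := hD₁.memLp.integrable_mul hX'm
      have h2 : Integrable (fun ω => D₁ ω * Y' ω) P := hD₁.memLp.integrable_mul hY'm
      rw [← integral_sub h1 h2]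
      simp [mul_sub]
    have hle : ∫ ω, D ω * Y ω ∂P - c * (δ + ε) ≤ ∫ ω, D₂ ω * X ω ∂P := by
      have : lpNorm D₁ (ENNReal.conjExponent (ENNReal.ofReal p)) P *
          lpNorm (X' - Y') (ENNReal.ofReal p) P ≤ c * (δ + ε) := by
        gcongr
        · exact lpNorm_nonneg
        · exact hD₁.lpNorm_le
      have := neg_le_of_abs_le (hH.trans this)
      rw [hE₂, ← hE₁]
      linarith
    rw [EVaR_eq_iSup_isDensity hp hα X]
    exact le_iSup₂_of_le D₂ hD₂ (by exact_mod_cast hle)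
  generalize EVaR P p α X = e at key
  induction e with
  | bot => exact absurd (le_bot_iff.1 (key 1 one_pos)) (EReal.coe_ne_bot _)
  | top => rw [EReal.top_add_coe]; exact le_top
  | coe e =>
    norm_cast at key ⊢
    refine le_of_forall_pos_le_add fun ε hε => ?_
    have := key (ε / (c + 1)) (by positivity)
    have h2 : c * (ε / (c + 1)) ≤ ε := by
      rw [← mul_div_assoc, div_le_iff₀ (by positivity)]
      linarith
    linarith

/-- The upper bound is approached by `Y = X + δ Z`, where `D'` nearly attains `EVaR` at `X`, satisfies
`‖D'‖_q = (1 - α) ^ (-1/p)`, and `Z` in the unit ball of `L^p` nearly attains `‖D'‖_q`. -/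
theorem exists_wasserstein_le_lt_EVaR [IsProbabilityMeasure P] (hP : Atomless P) {p α δ : ℝ}
    (hp : 1 ≤ p) (hα : α < 1) (hδ : 0 ≤ δ) {X : Ω → ℝ} (hX : MemLp X (ENNReal.ofReal p) P) {r : ℝ}
    (hr : (r : EReal) < EVaR P p α X + ((δ * (1 - α) ^ (-(1 / p)) : ℝ) : EReal)) :
    ∃ Y, MemLp Y (ENNReal.ofReal p) P ∧ wasserstein P p X Y ≤ ENNReal.ofReal δ ∧
      (r : EReal) < EVaR P p α Y := by
  have : (ENNReal.ofReal p).HolderConjugate (ENNReal.conjExponent (ENNReal.ofReal p)) :=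
      .conjExponent (by simpa using hp)
  set q := ENNReal.conjExponent (ENNReal.ofReal p)
  set c := (1 - α) ^ (-(1 / p))
  have hr' : ((r - δ * c : ℝ) : EReal) < EVaR P p α X := by
    generalize EVaR P p α X = e at hr
    induction e with
    | bot => simp at hr
    | top => exact EReal.coe_lt_top _
    | coe e => norm_cast at hr ⊢; linarith
  simp only [EVaR_eq_iSup_isDensity hp hα X, lt_iSup_iff, EReal.coe_lt_coe_iff] at hr'
  obtain ⟨D, hD, hlt⟩ := hr'
  set gap := ∫ ω, D ω * X ω ∂P - (r - δ * c)
  have hgap0 : 0 < gap := by linarith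
  obtain ⟨D', hD', hnorm, hDX⟩ := hD.exists_lpNorm_eq ENNReal.ofReal_ne_top hP hX (half_pos hgap0)
  obtain ⟨Z, hZ, hZ1, hDZ⟩ := hD'.exists_lpNorm_le_one (p := ENNReal.ofReal p)
    ENNReal.ofReal_ne_top (η := gap / (4 * (δ + 1))) (by positivity)
  have hY : MemLp (X + δ • Z) (ENNReal.ofReal p) P := hX.add (hZ.const_smul δ)
  refine ⟨X + δ • Z, hY, ?_, ?_⟩
  · refine (iInf₂_le_of_le X (X + δ • Z) (iInf₂_le
      (IdentDistrib.refl hX.1.aemeasurable) (IdentDistrib.refl hY.1.aemeasurable))).trans ?_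
    have hδZ := hZ.const_smul δ
    rw [show X - (X + δ • Z) = -(δ • Z) by abel, eLpNorm_neg, ← ofReal_lpNorm hδZ,
      lpNorm_const_smul, coe_nnnorm, Real.norm_of_nonneg hδ]
    exact ENNReal.ofReal_le_ofReal (mul_le_of_le_one_right hδ hZ1)
  · rw [EVaR_eq_iSup_isDensity hp hα]
    refine lt_of_lt_of_le ?_ (le_iSup₂_of_le D' hD' le_rfl)
    have h1 : Integrable (fun ω => D' ω * X ω) P := hD'.memLp.integrable_mul hX
    have h2 : Integrable (fun ω => D' ω * Z ω) P := hD'.memLp.integrable_mul hZ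
    have heq : ∫ ω, D' ω * (X + δ • Z) ω ∂P
        = ∫ ω, D' ω * X ω ∂P + δ * ∫ ω, D' ω * Z ω ∂P := by
      rw [← integral_const_mul, ← integral_add h1 (h2.const_mul δ)]
      congr 1 with ω
      simp only [Pi.add_apply, Pi.smul_apply, smul_eq_mul]
      ring
    rw [EReal.coe_lt_coe_iff, heq]
    have h3 : δ * (c - gap / (4 * (δ + 1))) ≤ δ * ∫ ω, D' ω * Z ω ∂P := by
      rw [hnorm] at hDZ
      gcongr
    have h4 : δ * (gap / (4 * (δ + 1))) ≤ gap / 4 := by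
      rw [← mul_div_assoc, div_le_div_iff₀ (by positivity) (by positivity)]
      nlinarith
    linarith

end LambdaEVaR

theorem proposition4p3 {Ω : Type*} [MeasurableSpace Ω] (P : MeasureTheory.Measure Ω)
    [MeasureTheory.IsProbabilityMeasure P] (hP : LambdaEVaR.Atomless P)
    (p δ : ℝ) (hp : 1 ≤ p) (hδ : 0 ≤ δ)
    (Λ : ℝ → ℝ) (hΛ : Antitone Λ) (hΛ01 : ∀ x, Λ x ∈ Set.Ico (0 : ℝ) 1)
    (X : Ω → ℝ) (hX : MeasureTheory.MemLp X (ENNReal.ofReal p) P) :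
    (⨆ (Y : Ω → ℝ) (_ : MeasureTheory.MemLp Y (ENNReal.ofReal p) P)
        (_ : LambdaEVaR.wasserstein P p X Y ≤ ENNReal.ofReal δ), LambdaEVaR.lambdaEVaR P p Λ Y)
      = ⨆ x : ℝ, (LambdaEVaR.EVaR P p (Λ x) X
          + ((δ * (1 - Λ x) ^ (-(1 / p)) : ℝ) : EReal)) ⊓ (x : EReal) := by
  apply le_antisymm
  · refine iSup_le fun Y => iSup₂_le fun hY hW => iSup_mono fun x => ?_
    exact inf_le_inf_right _
      (LambdaEVaR.EVaR_le_add_of_wasserstein_le hp (hΛ01 x).2 hδ hX hY hW)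
  · refine iSup_le fun x => EReal.ge_of_forall_gt_iff_ge.1 fun r hr => ?_
    obtain ⟨hr, hrx⟩ := lt_inf_iff.1 hr
    obtain ⟨Y, hY, hW, hlt⟩ :=
      LambdaEVaR.exists_wasserstein_le_lt_EVaR hP hp (hΛ01 x).2 hδ hX hr
    exact le_iSup_of_le Y (le_iSup₂_of_le hY hW (le_iSup_of_le x (le_inf hlt.le hrx.le)))
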